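/- Let $D_1,\dots,D_m\subseteq\mathbb R^n$ be nonempty closed (possibly nonconvex) sets. For a nonempty closed set $S$ write $d_S(x)$ for the distance from $x$ to $S$, $P_S(x)$ for the set of nearest points of $S$ to $x$, $\delta_S$ for the indicator function ($0$ on $S$, $+\infty$ off $S$), and $S^\infty=\{d:\exists\, y^t\in S,\ \lambda_t\downarrow 0,\ \lambda_t y^t\to d\}$ for the horizon cone. Let $\Theta$ be the set of continuous concave functions $\psi:\mathbb R_+\to\mathbb R_+$ with bounded sublevel sets such that $\psi(0)=0$, $\psi$ is continuously differentiable with positive derivative on $(0,\infty)$, $\lim_{s\downarrow0}\psi'(s)$ exists and is positive (and finite), and the right derivative $\psi'_+$ is Lipschitz continuous on $[0,\infty)$. For $\psi\in\Theta$ put $\Psi(x)=\sum_{i=1}^m\psi(d_{D_i}^2(x))$. Let $\rho(s)=-\psi(s)$ for $s\ge0$ and $\rho(s)=s^2-\psi'_+(0)s$ for $s<0$, let $\rho^*(u)=\sup_{s\in\mathbb R}\{us-\rho(s)\}$ be its convex conjugate, and define on $\mathbb R^n\times\mathbb R^{mn}\times\mathbb R^m$ the function $$F(x,\xi,u)=\sum_{i=1}^m\left[\rho^*(u_i)-u_i\|x-\xi_i\|^2+\delta_{D_i}(\xi_i)\right].$$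 For a proper lower semicontinuous $f$ with values in $(-\infty,\infty]$, let $\partial f$ be the limiting subdifferential: $v\in\partial f(x)$ if and only if $f(x)<\infty$ and there are $x^t\to x$ with $f(x^t)\to f(x)$ and $v^t\to v$ such that, for every $t$, $f(x^t)<\infty$ and $\liminf_{y\to x^t,\,y\ne x^t}\big(f(y)-f(x^t)-\langle v^t,y-x^t\rangle\big)/\|y-x^t\|\ge0$. Such an $f$ is a KL function if for every $\hat x$ with $\partial f(\hat x)\neq\emptyset$ there are a neighborhood $N$ of $\hat x$, $\nu\in(0,\infty]$, and a continuous concave $\phi:[0,\nu)\to\mathbb R_+$ with $\phi(0)=0$, continuously differentiable with positive derivative on $(0,\nu)$, such that $\phi'(f(x)-f(\hat x))\,\mathrm{dist}(0,\partial f(x))\ge1$ whenever $x\in N$ and $f(\hat x)<f(x)<f(\hat x)+\nu$ (with $\mathrm{dist}(0,\emptyset)=+\infty$). Consider the following algorithm (the subgradient projection algorithm with linesearch, for $C=\mathbb R^n$ and monotone linesearch $M=0$). Choose $\alpha_{\max}>\alpha_{\min}>0$, $\eta\in(0,1)$, $\sigma>0$ and $x^0\in\mathbb R^n$. For $t=0,1,2,\dots$: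 choose any $\alpha_t^0\in[\alpha_{\min},\alpha_{\max}]$ and any $\xi_i^t\in P_{D_i}(x^t)$, $i=1,\dots,m$, and set $g^t=2\sum_{i=1}^m\psi'_+(d_{D_i}^2(x^t))(x^t-\xi_i^t)$. Successively for $\alpha=\alpha_t^0,\eta\alpha_t^0,\eta^2\alpha_t^0,\dots$ let $\tilde u$ be a minimizer over $u\in\mathbb R^n$ of $\langle g^t,u-x^t\rangle+\frac1{2\alpha}\|u-x^t\|^2$; for the first $\alpha$ with $\Psi(\tilde u)-\Psi(x^t)\le-\frac\sigma2\|\tilde u-x^t\|^2$, set $x^{t+1}=\tilde u$. **Theorem.** Suppose that $\bigcap_{i=1}^mD_i^\infty=\{0\}$, $\psi\in\Theta$, and $F$ is a KL function. Then every sequence $\{x^t\}$ generated by this algorithm converges, and its limit $\bar x$ is a stationary point of $\Psi$ in the sense that $$0\in\sum_{i=1}^m2\psi'_+(d_{D_i}^2(\bar x))\,(\bar x-P_{D_i}(\bar x)).$$ -/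

import Mathlib

open Filter Topology

noncomputable section

namespace SGP

/-! ### Variational analysis: extended-real-valued functions, subdifferentials, KL functions -/

section Variational

variable {E : Type*} [NormedAddCommGroup E] [InnerProductSpace ℝ E]

/-- The indicator function `δ_S` of a set `S`: `0` on `S` and `+∞` off `S`. -/
def indicatorFn (S : Set E) (x : E) : EReal :=
  open scoped Classical in if x ∈ S then 0 else ⊤

/-- `f` is proper (finite somewhere, nowhere `-∞`) and closed (lower semicontinuous). -/
def IsProperClosed (f : E → EReal) : Prop :=
  (∃ x, f x < ⊤) ∧ (∀ x, f x ≠ ⊥) ∧ LowerSemicontinuous f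

/-- The regular subdifferential of `f` at `x`; it is empty if `f x = +∞`. -/
def regularSubdiff (f : E → EReal) (x : E) : Set E :=
  {v | f x < ⊤ ∧
    0 ≤ liminf (fun y => (f y - f x - ((inner ℝ v (y - x) : ℝ) : EReal)) / ((‖y - x‖ : ℝ) : EReal))
      (𝓝[≠] x)}

/-- The limiting subdifferential of `f` at `x`; it is empty if `f x = +∞`. -/
def limitingSubdiff (f : E → EReal) (x : E) : Set E :=
  {v | f x < ⊤ ∧ ∃ (xs vs : ℕ → E),
    Tendsto xs atTop (𝓝 x) ∧ Tendsto (fun t => f (xs t)) atTop (𝓝 (f x)) ∧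
    (∀ t, vs t ∈ regularSubdiff f (xs t)) ∧ Tendsto vs atTop (𝓝 v)}

/-- The (limiting) normal cone `N_S(x) = ∂δ_S(x)`. -/
def normalCone (S : Set E) (x : E) : Set E := limitingSubdiff (indicatorFn S) x

/-- The class `Ξ_ν` of desingularizing functions on `[0, ν)`, where `ν ∈ (0, ∞]`. -/
structure IsDesingularizing (ν : EReal) (φ : ℝ → ℝ) : Prop where
  continuousOn : ContinuousOn φ {s : ℝ | 0 ≤ s ∧ (s : EReal) < ν}
  concaveOn : ConcaveOn ℝ {s : ℝ | 0 ≤ s ∧ (s : EReal) < ν} φ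
  nonneg : ∀ s : ℝ, 0 ≤ s → (s : EReal) < ν → 0 ≤ φ s
  contDiffOn : ContDiffOn ℝ 1 φ {s : ℝ | 0 < s ∧ (s : EReal) < ν}
  deriv_pos : ∀ s : ℝ, 0 < s → (s : EReal) < ν → 0 < deriv φ s
  map_zero : φ 0 = 0

/-- The Kurdyka–Łojasiewicz property of `f` at `x₀`. The distance from `0` to `∂f(x)` is taken
in `[0, ∞]`, so that it is `+∞` if `∂f(x)` is empty. -/
def HasKLAt (f : E → EReal) (x₀ : E) : Prop :=
  ∃ N ∈ 𝓝 x₀, ∃ ν : EReal, 0 < ν ∧ ∃ φ : ℝ → ℝ, IsDesingularizing ν φ ∧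
    ∀ x ∈ N, f x₀ < f x → f x < f x₀ + ν →
      1 ≤ ENNReal.ofReal (deriv φ ((f x).toReal - (f x₀).toReal)) *
        Metric.infEDist 0 (limitingSubdiff f x)

/-- `f` is a KL function: it is proper and closed and has the KL property at every point
of `dom ∂f`. -/
def IsKLFunction (f : E → EReal) : Prop :=
  IsProperClosed f ∧ ∀ x, (limitingSubdiff f x).Nonempty → HasKLAt f x

/-- The horizon cone `S^∞` of a set `S`. -/
def horizonCone (S : Set E) : Set E :=
  {d | ∃ (xs : ℕ → E) (lam : ℕ → ℝ), (∀ t, xs t ∈ S) ∧ (∀ t, 0 < lam t) ∧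
    Tendsto lam atTop (𝓝 0) ∧ Tendsto (fun t => lam t • xs t) atTop (𝓝 d)}

/-- The set `P_S(x)` of projections of `x` onto `S`. -/
def proj (S : Set E) (x : E) : Set E := {y | y ∈ S ∧ dist x y = Metric.infDist x S}

end Variational

/-! ### The class `Θ` -/

/-- The right derivative `ψ'_+(s)`. -/
def rightDeriv (ψ : ℝ → ℝ) (s : ℝ) : ℝ := derivWithin ψ (Set.Ioi s) s

/-- The class `Θ` of functions `ψ : ℝ₊ → ℝ₊`. Such a function is represented by a function on `ℝ`
of which only the values on `[0, ∞)` matter. -/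
structure IsTheta (ψ : ℝ → ℝ) : Prop where
  nonneg : ∀ s, 0 ≤ s → 0 ≤ ψ s
  continuousOn : ContinuousOn ψ (Set.Ici 0)
  concaveOn : ConcaveOn ℝ (Set.Ici 0) ψ
  levelBounded : ∀ r : ℝ, Bornology.IsBounded {s : ℝ | 0 ≤ s ∧ ψ s ≤ r}
  contDiffOn : ContDiffOn ℝ 1 ψ (Set.Ioi 0)
  deriv_pos : ∀ s, 0 < s → 0 < deriv ψ s
  map_zero : ψ 0 = 0
  tendsto_deriv : ∃ l : ℝ, 0 < l ∧ Tendsto (deriv ψ) (𝓝[>] 0) (𝓝 l)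
  lipschitz_rightDeriv : ∃ K : NNReal, LipschitzOnWith K (rightDeriv ψ) (Set.Ici 0)

/-! ### The problem, the algorithm and stationarity -/

section Algorithm

variable {E : Type*} [NormedAddCommGroup E] [InnerProductSpace ℝ E] {m : ℕ}

/-- The objective `Ψ(x) = ∑ᵢ ψ(d_{Dᵢ}(x)²)`. -/
def objective (ψ : ℝ → ℝ) (D : Fin m → Set E) (x : E) : ℝ :=
  ∑ i, ψ (Metric.infDist x (D i) ^ 2)

/-- The direction `2 ∑ᵢ ψ'_+(d_{Dᵢ}(x)²) (x - ξᵢ)`. -/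
def direction (ψ : ℝ → ℝ) (D : Fin m → Set E) (x : E) (ξ : Fin m → E) : E :=
  (2 : ℝ) • ∑ i, rightDeriv ψ (Metric.infDist x (D i) ^ 2) • (x - ξ i)

/-- The minimizers over `u ∈ C` of `⟨g, u - x⟩ + ‖u - x‖² / (2α)`. -/
def proxArgmin (C : Set E) (x g : E) (α : ℝ) : Set E :=
  {u | u ∈ C ∧ IsMinOn (fun w => inner ℝ g (w - x) + 1 / (2 * α) * ‖w - x‖ ^ 2) C u}

/-- The linesearch criterion
`Ψ(u) - max_{[t-M]₊ ≤ i ≤ t} Ψ(x^i) ≤ -(σ/2) ‖u - x^t‖²`. -/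
def LinesearchOK (ψ : ℝ → ℝ) (D : Fin m → Set E) (σ : ℝ) (M : ℕ) (x : ℕ → E) (t : ℕ) (u : E) :
    Prop :=
  objective ψ D u -
      (Finset.Icc (t - M) t).sup' (Finset.nonempty_Icc.mpr (Nat.sub_le t M))
        (fun i => objective ψ D (x i)) ≤
    -(σ / 2) * ‖u - x t‖ ^ 2

/-- `x` is a sequence generated by the subgradient projection algorithm with nonmonotone linesearch
for minimizing `Ψ` over `C`, with parameters `αmin`, `αmax`, `η`, `σ`, `M`. In iteration `t`, the
trial point `u j` uses the stepsize `η ^ j * α₀`; the first `k` trial points are rejected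
and `u k` is accepted. -/
structure IsGenerated (C : Set E) (D : Fin m → Set E) (ψ : ℝ → ℝ)
    (αmin αmax η σ : ℝ) (M : ℕ) (x : ℕ → E) : Prop where
  αmin_pos : 0 < αmin
  αmin_lt_αmax : αmin < αmax
  η_pos : 0 < η
  η_lt_one : η < 1
  σ_pos : 0 < σ
  init : x 0 ∈ C
  step : ∀ t, ∃ α₀ ∈ Set.Icc αmin αmax, ∃ ξ : Fin m → E, (∀ i, ξ i ∈ proj (D i) (x t)) ∧
    ∃ (k : ℕ) (u : ℕ → E),
      (∀ j ≤ k, u j ∈ proxArgmin C (x t) (direction ψ D (x t) ξ) (η ^ j * α₀)) ∧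
      (∀ j < k, ¬ LinesearchOK ψ D σ M x t (u j)) ∧
      LinesearchOK ψ D σ M x t (u k) ∧
      x (t + 1) = u k

/-- `x` is a stationary point of `Ψ + δ_C`:
`0 ∈ ∑ᵢ 2 ψ'_+(d_{Dᵢ}(x)²) (x - P_{Dᵢ}(x)) + N_C(x)`. -/
def IsStationary (C : Set E) (D : Fin m → Set E) (ψ : ℝ → ℝ) (x : E) : Prop :=
  ∃ ξ : Fin m → E, (∀ i, ξ i ∈ proj (D i) x) ∧
    ∃ w ∈ normalCone C x, direction ψ D x ξ + w = 0

end Algorithm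

/-! ### The lifted potential -/

/-- The function `ρ` on `ℝ`: `-ψ(s)` for `s ≥ 0` and `s² - ψ'_+(0) s` for `s < 0`. -/
def rho (ψ : ℝ → ℝ) (s : ℝ) : ℝ :=
  if 0 ≤ s then -ψ s else s ^ 2 - rightDeriv ψ 0 * s

/-- The convex conjugate of a function on `ℝ`. -/
def conjugate (h : ℝ → ℝ) (u : ℝ) : EReal := ⨆ s : ℝ, ((u * s - h s : ℝ) : EReal)

/-- The Euclidean space `ℝⁿ × ℝᵐⁿ × ℝᵐ` of the triples `(x, ξ, u)`. -/
abbrev LiftedSpace (n m : ℕ) : Type :=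
  WithLp 2 (EuclideanSpace ℝ (Fin n) ×
    WithLp 2 (PiLp 2 (fun _ : Fin m => EuclideanSpace ℝ (Fin n)) × EuclideanSpace ℝ (Fin m)))

/-- The potential `F(x, ξ, u) = ∑ᵢ [ρ*(uᵢ) - uᵢ ‖x - ξᵢ‖² + δ_{Dᵢ}(ξᵢ)]`. -/
def potential {n m : ℕ} (ψ : ℝ → ℝ) (D : Fin m → Set (EuclideanSpace ℝ (Fin n)))
    (z : LiftedSpace n m) : EReal :=
  ∑ i, (conjugate (rho ψ) (z.snd.snd i) -
      ((z.snd.snd i * ‖z.fst - z.snd.fst i‖ ^ 2 : ℝ) : EReal) +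
    indicatorFn (D i) (z.snd.fst i))

end SGP

end

/-!
The potential `F` is a lift of `Ψ`: minimizing `F(x, ξ, u)` over `ξ` and `u` gives `Ψ(x)`, and the
minimum is attained at any choice of projections `ξᵢ` of `x` and `uᵢ = -ψ'_+(d_{Dᵢ}(x)²)`. Although
`Ψ` is in general not subdifferentiable in the regular sense, `F` is so at every such point: by
Fenchel's inequality and the optimality of the projections, `F` lies above its affine model with
slope `(g, 0, 0)`, where `g = 2 ∑ᵢ ψ'_+(d_{Dᵢ}(x)²) (x - ξᵢ)`, up to a quadratic error
(`direction_mem_regularSubdiff`). So the slope of `F` above an iterate is at most the norm of the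
direction `g` used by the algorithm.

Concavity of `ψ` gives a quadratic upper bound on `Ψ` around each iterate
(`objective_le_quadratic`). Hence the linesearch keeps the stepsizes away from zero, the norm of `g`
is at most a multiple of the step length, and each step decreases `Ψ` by a multiple of the squared
step length (`IsGenerated.exists_step`). The horizon condition keeps the iterates and their
projections in a compact set (`isBounded_objective_le`), and by continuity any cluster point
`(x̄, ξ̄)` consists of a stationary point and projections of it.

The Kurdyka–Łojasiewicz inequality of `F` at the lift of a cluster point bounds a nearby step length
by the decrease of the desingularized gap `φ(Ψ(xᵗ) - lim Ψ)` (`kl_step`). The projections may jump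
between different cluster points even when the iterates hardly move, so one cluster point does not
suffice: a compactness argument adds up the desingularizing functions of finitely many of them
(`summable_of_locally_controlled`). The step lengths are therefore summable, and the iterates
converge.
-/

namespace SGP

/-! ### Functions of the class `Θ` and the conjugate of `ρ` -/

lemma le_tangent_of_concaveOn {S : Set ℝ} {f : ℝ → ℝ} {f' a b : ℝ}
    (hf : ConcaveOn ℝ S f) (ha : a ∈ S) (hb : b ∈ S) (hd : HasDerivAt f f' a) :
    f b ≤ f a + f' * (b - a) := by
  rcases lt_trichotomy a b with h | h | h
  · have := hf.slope_le_of_hasDerivAt ha hb h hd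
    rw [slope_def_field, div_le_iff₀ (sub_pos.2 h)] at this
    linarith
  · subst h; simp
  · have := hf.le_slope_of_hasDerivAt hb ha h hd
    rw [slope_def_field, le_div_iff₀ (sub_pos.2 h)] at this
    linarith

lemma le_conjugate_rho (ψ : ℝ → ℝ) {s : ℝ} (hs : 0 ≤ s) (u : ℝ) :
    ((u * s + ψ s : ℝ) : EReal) ≤ conjugate (rho ψ) u := by
  refine le_trans (le_of_eq ?_) (le_iSup _ s)
  simp [rho, hs]

namespace IsTheta

variable {ψ : ℝ → ℝ}

lemma hasDerivAt (hψ : IsTheta ψ) {s : ℝ} (hs : 0 < s) : HasDerivAt ψ (rightDeriv ψ s) s := by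
  have hd : DifferentiableAt ℝ ψ s :=
    (hψ.contDiffOn.differentiableOn one_ne_zero).differentiableAt (Ioi_mem_nhds hs)
  rw [rightDeriv, hd.derivWithin (uniqueDiffWithinAt_Ioi s)]
  exact hd.hasDerivAt

lemma hasDerivWithinAt_zero (hψ : IsTheta ψ) : HasDerivWithinAt ψ (rightDeriv ψ 0) (Set.Ioi 0) 0 := by
  obtain ⟨l, -, hl⟩ := hψ.tendsto_deriv
  have h := (hasDerivWithinAt_Ici_of_tendsto_deriv
    (hψ.contDiffOn.differentiableOn one_ne_zero)
    ((hψ.continuousOn 0 Set.self_mem_Ici).mono Set.Ioi_subset_Ici_self)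
    self_mem_nhdsWithin hl).mono Set.Ioi_subset_Ici_self
  rwa [rightDeriv, h.derivWithin (uniqueDiffWithinAt_Ioi 0)]

lemma le_tangent (hψ : IsTheta ψ) {s t : ℝ} (hs : 0 ≤ s) (ht : 0 ≤ t) :
    ψ t ≤ ψ s + rightDeriv ψ s * (t - s) := by
  rcases hs.eq_or_lt with rfl | hs'
  · rcases ht.eq_or_lt with rfl | ht'
    · simp
    have := hψ.concaveOn.slope_le_of_hasDerivWithinAt_Ioi hs ht ht' hψ.hasDerivWithinAt_zero
    rw [slope_def_field, div_le_iff₀ (sub_pos.2 ht')] at this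
    linarith
  · exact le_tangent_of_concaveOn hψ.concaveOn hs ht (hψ.hasDerivAt hs')

lemma rightDeriv_le_zero (hψ : IsTheta ψ) {s : ℝ} (hs : 0 ≤ s) : rightDeriv ψ s ≤ rightDeriv ψ 0 := by
  rcases hs.eq_or_lt with rfl | hs'
  · rfl
  have h1 := hψ.le_tangent le_rfl hs
  have h2 := hψ.le_tangent hs le_rfl
  nlinarith

lemma rightDeriv_pos (hψ : IsTheta ψ) {s : ℝ} (hs : 0 ≤ s) : 0 < rightDeriv ψ s := by
  have key : ∀ r, 0 < r → 0 < rightDeriv ψ r := fun r hr => by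
    rw [← (hψ.hasDerivAt hr).deriv]; exact hψ.deriv_pos r hr
  rcases hs.eq_or_lt with rfl | hs'
  · exact (key 1 one_pos).trans_le (hψ.rightDeriv_le_zero zero_le_one)
  · exact key s hs'

lemma continuousOn_rightDeriv (hψ : IsTheta ψ) : ContinuousOn (rightDeriv ψ) (Set.Ici 0) := by
  obtain ⟨K, hK⟩ := hψ.lipschitz_rightDeriv
  exact hK.continuousOn

/-- Equality holds in Fenchel's inequality at `u = ρ'(s) = -ψ'_+(s)`, because `ρ` lies above its
tangents at nonnegative points. -/
lemma conjugate_neg_rightDeriv (hψ : IsTheta ψ) {s : ℝ} (hs : 0 ≤ s) :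
    conjugate (rho ψ) (-rightDeriv ψ s) = ((-rightDeriv ψ s * s + ψ s : ℝ) : EReal) := by
  refine le_antisymm (iSup_le fun t => EReal.coe_le_coe_iff.2 ?_) (le_conjugate_rho ψ hs _)
  unfold rho
  split_ifs with ht
  · have := hψ.le_tangent hs ht
    linarith
  · have h1 := hψ.le_tangent hs le_rfl
    have h2 := hψ.rightDeriv_le_zero hs
    rw [hψ.map_zero] at h1
    nlinarith [sq_nonneg t]

end IsTheta

/-! ### The objective: descent inequality, stepsizes and level sets -/

section Objective

variable {n m : ℕ} {ψ : ℝ → ℝ} {D : Fin m → Set (EuclideanSpace ℝ (Fin n))}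

lemma infDist_eq_of_mem_proj {S : Set (EuclideanSpace ℝ (Fin n))} {x y : EuclideanSpace ℝ (Fin n)}
    (h : y ∈ proj S x) : Metric.infDist x S = ‖x - y‖ := by
  rw [← h.2, dist_eq_norm]

lemma objective_nonneg (hψ : IsTheta ψ) (x : EuclideanSpace ℝ (Fin n)) : 0 ≤ objective ψ D x :=
  Finset.sum_nonneg fun _ _ => hψ.nonneg _ (sq_nonneg _)

lemma continuous_objective (hψ : IsTheta ψ) : Continuous (objective ψ D) :=
  continuous_finsetSum _ fun i _ => hψ.continuousOn.comp_continuous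
    ((Metric.continuous_infDist_pt (D i)).pow 2) fun _ => Set.mem_Ici.2 (sq_nonneg _)

lemma inner_direction (x : EuclideanSpace ℝ (Fin n)) (ξ : Fin m → EuclideanSpace ℝ (Fin n))
    (w : EuclideanSpace ℝ (Fin n)) :
    inner ℝ (direction ψ D x ξ) w =
      ∑ i, 2 * rightDeriv ψ (Metric.infDist x (D i) ^ 2) * inner ℝ (x - ξ i) w := by
  simp only [direction, inner_smul_left, sum_inner, Finset.mul_sum]
  simp [mul_assoc]

/-- The quadratic upper bound on `Ψ`: `ψ` is concave and the squared distance to `Dᵢ` is at most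
the squared distance to the chosen projection. -/
lemma objective_le_quadratic (hψ : IsTheta ψ) {x : EuclideanSpace ℝ (Fin n)}
    {ξ : Fin m → EuclideanSpace ℝ (Fin n)} (hξ : ∀ i, ξ i ∈ proj (D i) x)
    (y : EuclideanSpace ℝ (Fin n)) :
    objective ψ D y ≤ objective ψ D x + inner ℝ (direction ψ D x ξ) (y - x) +
      m * rightDeriv ψ 0 * ‖y - x‖ ^ 2 := by
  have key : ∀ i, ψ (Metric.infDist y (D i) ^ 2) ≤ ψ (Metric.infDist x (D i) ^ 2) +
      2 * rightDeriv ψ (Metric.infDist x (D i) ^ 2) * inner ℝ (x - ξ i) (y - x) +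
      rightDeriv ψ 0 * ‖y - x‖ ^ 2 := by
    intro i
    have h1 := hψ.le_tangent (sq_nonneg (Metric.infDist x (D i)))
      (sq_nonneg (Metric.infDist y (D i)))
    have h2 : Metric.infDist y (D i) ^ 2 ≤ ‖x - ξ i‖ ^ 2 + 2 * inner ℝ (x - ξ i) (y - x) +
        ‖y - x‖ ^ 2 := by
      rw [← norm_add_sq_real, show x - ξ i + (y - x) = y - ξ i by abel, ← dist_eq_norm]
      exact pow_le_pow_left₀ Metric.infDist_nonneg (Metric.infDist_le_dist_of_mem (hξ i).1) 2
    rw [← infDist_eq_of_mem_proj (hξ i)] at h2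
    have h3 := (hψ.rightDeriv_pos (sq_nonneg (Metric.infDist x (D i)))).le
    have h4 := mul_le_mul_of_nonneg_right
      (hψ.rightDeriv_le_zero (sq_nonneg (Metric.infDist x (D i)))) (sq_nonneg ‖y - x‖)
    have h5 := mul_le_mul_of_nonneg_left h2 h3
    linarith
  have := Finset.sum_le_sum fun i (_ : i ∈ Finset.univ) => key i
  simp only [Finset.sum_add_distrib, Finset.sum_const, Finset.card_univ, Fintype.card_fin,
    nsmul_eq_mul] at this
  rw [inner_direction]
  simpa only [objective, mul_assoc] using this

/-- Completing the square, the trial point is the explicit gradient step. -/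
lemma eq_of_mem_proxArgmin {x g u : EuclideanSpace ℝ (Fin n)} {α : ℝ} (hα : 0 < α)
    (hu : u ∈ proxArgmin Set.univ x g α) : u - x = -(α • g) := by
  have h := hu.2 (Set.mem_univ (x - α • g))
  simp only [Set.mem_ofPred_eq] at h
  have e : ‖(u - x) + α • g‖ ^ 2 ≤ 0 := by
    rw [norm_add_sq_real, inner_smul_right, norm_smul, Real.norm_of_nonneg hα.le,
      real_inner_comm]
    rw [show x - α • g - x = -(α • g) by abel, inner_neg_right, inner_smul_right, norm_neg,
      norm_smul, Real.norm_of_nonneg hα.le, real_inner_self_eq_norm_sq] at h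
    field_simp at h
    nlinarith
  have e' : (u - x) + α • g = 0 := by
    rw [← norm_eq_zero]; exact pow_eq_zero_iff two_ne_zero |>.1 (le_antisymm e (sq_nonneg _))
  exact eq_neg_of_add_eq_zero_left e'

/-- The linesearch keeps the stepsizes away from zero, and each step decreases `Ψ` sufficiently. -/
lemma IsGenerated.exists_step (hψ : IsTheta ψ) {αmin αmax η σ : ℝ}
    {x : ℕ → EuclideanSpace ℝ (Fin n)} (hx : IsGenerated Set.univ D ψ αmin αmax η σ 0 x) :
    ∃ c > 0, ∀ t, ∃ ξ : Fin m → EuclideanSpace ℝ (Fin n), (∀ i, ξ i ∈ proj (D i) (x t)) ∧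
      c * ‖direction ψ D (x t) ξ‖ ≤ ‖x (t + 1) - x t‖ ∧
      objective ψ D (x (t + 1)) + σ / 2 * ‖x (t + 1) - x t‖ ^ 2 ≤ objective ψ D (x t) := by
  have hL : 0 < m * rightDeriv ψ 0 + σ / 2 := by
    have := hψ.rightDeriv_pos le_rfl
    have := hx.σ_pos
    positivity
  have hη := hx.η_pos
  refine ⟨min αmin (η / (m * rightDeriv ψ 0 + σ / 2)), lt_min hx.αmin_pos (by positivity),
    fun t => ?_⟩
  obtain ⟨α₀, hα₀, ξ, hξ, k, u, hu, hrej, hacc, hxt⟩ := hx.step t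
  have hpos : ∀ j, 0 < η ^ j * α₀ := fun j => mul_pos (pow_pos hη j) (hx.αmin_pos.trans_le hα₀.1)
  refine ⟨ξ, hξ, ?_, ?_⟩
  · rw [hxt, eq_of_mem_proxArgmin (hpos k) (hu k le_rfl), norm_neg, norm_smul,
      Real.norm_of_nonneg (hpos k).le]
    refine mul_le_mul_of_nonneg_right ?_ (norm_nonneg _)
    rcases k with _ | k
    · simpa using Or.inl hα₀.1
    refine (min_le_right _ _).trans ?_
    -- The rejected stepsize before the accepted one already exceeds `1 / (m ψ'_+(0) + σ / 2)`.
    have h1 := hrej k (Nat.lt_succ_self k)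
    have h2 := eq_of_mem_proxArgmin (hpos k) (hu k (Nat.le_succ k))
    have h3 := objective_le_quadratic hψ hξ (u k)
    simp only [LinesearchOK, Nat.sub_zero, Finset.Icc_self, Finset.sup'_singleton, not_le] at h1
    set α := η ^ k * α₀ with hα
    rw [h2, inner_neg_right, inner_smul_right, real_inner_self_eq_norm_sq, norm_neg, norm_smul,
      Real.norm_of_nonneg (hpos k).le] at h3
    rw [h2, norm_neg, norm_smul, Real.norm_of_nonneg (hpos k).le] at h1
    have h4 : 0 < (‖direction ψ D (x t) ξ‖ ^ 2 * α) *
        ((m * rightDeriv ψ 0 + σ / 2) * α - 1) := by nlinarith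
    have h5 := pos_of_mul_pos_right h4 (mul_nonneg (sq_nonneg _) (hpos k).le)
    rw [pow_succ, mul_right_comm, ← hα, div_le_iff₀ hL]
    nlinarith
  · simp only [LinesearchOK, Nat.sub_zero, Finset.Icc_self, Finset.sup'_singleton] at hacc
    rw [hxt]
    linarith

/-- The horizon condition makes `Ψ` level-bounded: normalized points along an unbounded sequence in
a level set accumulate at a unit vector in the horizon cone of every `Dᵢ`. -/
lemma isBounded_objective_le (hψ : IsTheta ψ) (hne : ∀ i, (D i).Nonempty)
    (hcl : ∀ i, IsClosed (D i)) (hhor : ⋂ i, horizonCone (D i) = {0}) (r : ℝ) :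
    Bornology.IsBounded {x | objective ψ D x ≤ r} := by
  by_contra hub
  have hex : ∀ k : ℕ, ∃ x, objective ψ D x ≤ r ∧ (k : ℝ) + 1 < ‖x‖ := by
    intro k
    by_contra! h
    exact hub ((Metric.isBounded_closedBall (x := 0) (r := (k : ℝ) + 1)).subset fun x hx =>
      mem_closedBall_zero_iff.2 (h x hx))
  choose y hyr hyn using hex
  obtain ⟨B, hB⟩ := (hψ.levelBounded r).exists_norm_le
  -- Each summand of `Ψ` is nonnegative, so level-boundedness of `ψ` bounds every distance.
  have hdist : ∀ i k, Metric.infDist (y k) (D i) ^ 2 ≤ B := by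
    intro i k
    refine (le_abs_self _).trans (hB _ ⟨sq_nonneg _, le_trans ?_ (hyr k)⟩)
    exact Finset.single_le_sum (f := fun i => ψ (Metric.infDist (y k) (D i) ^ 2))
      (fun j _ => hψ.nonneg _ (sq_nonneg _)) (Finset.mem_univ i)
  have hpos : ∀ k, 0 < ‖y k‖ := fun k => by
    have := hyn k
    have : (0 : ℝ) ≤ k := k.cast_nonneg
    linarith
  have hlam : Tendsto (fun k => ‖y k‖⁻¹) atTop (𝓝 0) :=
    tendsto_inv_atTop_zero.comp <| tendsto_atTop_mono
      (fun k => (lt_add_one _).le.trans (hyn k).le) tendsto_natCast_atTop_atTop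
  obtain ⟨d, hd, φ, hφ, hlim⟩ := (isCompact_sphere (0 : EuclideanSpace ℝ (Fin n)) 1).tendsto_subseq
    (x := fun k => ‖y k‖⁻¹ • y k) fun k => by
      rw [mem_sphere_zero_iff_norm, norm_smul, norm_inv, norm_norm, inv_mul_cancel₀ (hpos k).ne']
  have hmem : d ∈ ⋂ i, horizonCone (D i) := by
    refine Set.mem_iInter.2 fun i => ?_
    choose ζ hζ hζd using fun k => (hcl i).exists_infDist_eq_dist (hne i) (y k)
    refine ⟨ζ ∘ φ, fun k => ‖y (φ k)‖⁻¹, fun k => hζ _, fun k => inv_pos.2 (hpos _),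
      hlam.comp hφ.tendsto_atTop, ?_⟩
    have hdiff : Tendsto (fun k => ‖y k‖⁻¹ • (ζ k - y k)) atTop (𝓝 0) := by
      refine hlam.zero_smul_isBoundedUnder_le ?_
      refine isBoundedUnder_of ⟨1 + B, fun k => ?_⟩
      have h1 := hdist i k
      rw [hζd k, dist_comm, dist_eq_norm] at h1
      simp only [Function.comp_apply]
      nlinarith [sq_nonneg (‖ζ k - y k‖ - 1)]
    have := hlim.add (hdiff.comp hφ.tendsto_atTop)
    rw [add_zero] at this
    refine this.congr fun k => ?_
    simp only [Function.comp_apply]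
    rw [← smul_add, add_sub_cancel]
  rw [hhor, Set.mem_singleton_iff] at hmem
  simp [hmem] at hd

end Objective

end SGP

namespace SGP

/-! ### The potential above an iterate and its regular subgradient -/

section Lift

variable {n m : ℕ} {ψ : ℝ → ℝ} {D : Fin m → Set (EuclideanSpace ℝ (Fin n))}

/-- The lift `(x, ξ, u)` of `x` with `uᵢ = -ψ'_+(d_{Dᵢ}(x)²)`, the value of `u` at which `F(x, ξ, u)`
equals `Ψ(x)` if every `ξᵢ` is a projection of `x` onto `Dᵢ`. -/
noncomputable def lift (ψ : ℝ → ℝ) (D : Fin m → Set (EuclideanSpace ℝ (Fin n)))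
    (x : EuclideanSpace ℝ (Fin n)) (ξ : Fin m → EuclideanSpace ℝ (Fin n)) : LiftedSpace n m :=
  WithLp.toLp 2 (x, WithLp.toLp 2 (WithLp.toLp 2 ξ,
    WithLp.toLp 2 fun i => -rightDeriv ψ (Metric.infDist x (D i) ^ 2)))

lemma coe_ereal_sum {ι : Type*} (s : Finset ι) (f : ι → ℝ) :
    ((∑ i ∈ s, f i : ℝ) : EReal) = ∑ i ∈ s, (f i : EReal) :=
  map_sum (⟨⟨Real.toEReal, EReal.coe_zero⟩, EReal.coe_add⟩ : ℝ →+ EReal) f s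

lemma potential_lift (hψ : IsTheta ψ) {x : EuclideanSpace ℝ (Fin n)}
    {ξ : Fin m → EuclideanSpace ℝ (Fin n)} (hξ : ∀ i, ξ i ∈ proj (D i) x) :
    potential ψ D (lift ψ D x ξ) = (objective ψ D x : EReal) := by
  rw [objective, coe_ereal_sum]
  refine Finset.sum_congr rfl fun i _ => ?_
  change conjugate (rho ψ) (-rightDeriv ψ (Metric.infDist x (D i) ^ 2)) -
    ((-rightDeriv ψ (Metric.infDist x (D i) ^ 2) * ‖x - ξ i‖ ^ 2 : ℝ) : EReal) +
    indicatorFn (D i) (ξ i) = _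
  rw [hψ.conjugate_neg_rightDeriv (sq_nonneg _), indicatorFn, if_pos (hξ i).1, add_zero,
    ← infDist_eq_of_mem_proj (hξ i), ← EReal.coe_sub]
  congr 1
  ring

/-- The difference of the squared norms of nearby vectors, with an explicit Lipschitz bound. -/
lemma abs_norm_sq_sub_norm_sq_le {E : Type*} [SeminormedAddCommGroup E] {a b : E} {r : ℝ}
    (hr : r ≤ 1) (h : ‖b - a‖ ≤ 2 * r) :
    |‖b‖ ^ 2 - ‖a‖ ^ 2| ≤ 4 * (1 + ‖a‖) * r := by
  have h1 : |‖b‖ - ‖a‖| ≤ 2 * r := (abs_norm_sub_norm_le b a).trans h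
  have h2 : ‖b‖ + ‖a‖ ≤ 2 * (1 + ‖a‖) := by linarith [(le_abs_self _).trans h1]
  have h3 : 0 ≤ ‖b‖ + ‖a‖ := by positivity
  rw [show ‖b‖ ^ 2 - ‖a‖ ^ 2 = (‖b‖ - ‖a‖) * (‖b‖ + ‖a‖) by ring, abs_mul, abs_of_nonneg h3]
  calc |‖b‖ - ‖a‖| * (‖b‖ + ‖a‖) ≤ (2 * r) * (2 * (1 + ‖a‖)) :=
        mul_le_mul h1 h2 h3 ((abs_nonneg _).trans h1)
    _ = 4 * (1 + ‖a‖) * r := by ring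

/-- A quadratic lower bound on the change of one summand of the potential. Fenchel's inequality
disposes of `ρ*`, and the optimality of the projection `ξ` of the change of `ξ`. -/
lemma potential_term_ge (hψ : IsTheta ψ) {S : Set (EuclideanSpace ℝ (Fin n))}
    {x ξ x' ξ' : EuclideanSpace ℝ (Fin n)} {u' r : ℝ} (hξ : ξ ∈ proj S x) (hr : r ≤ 1)
    (hx' : ‖x' - x‖ ≤ r) (hξ' : ‖ξ' - ξ‖ ≤ r)
    (hu' : |u' + rightDeriv ψ (Metric.infDist x S ^ 2)| ≤ r) :
    ((ψ (Metric.infDist x S ^ 2) +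
        2 * rightDeriv ψ (Metric.infDist x S ^ 2) * inner ℝ (x - ξ) (x' - x) -
        (2 * rightDeriv ψ (Metric.infDist x S ^ 2) + 4 * (1 + Metric.infDist x S)) * r ^ 2 : ℝ) :
        EReal) ≤
      conjugate (rho ψ) u' - ((u' * ‖x' - ξ'‖ ^ 2 : ℝ) : EReal) + indicatorFn S ξ' := by
  set s := Metric.infDist x S ^ 2 with hs
  have hs0 : 0 ≤ s := sq_nonneg _
  have hconj := le_conjugate_rho ψ hs0 u'
  have hsub := EReal.sub_le_sub hconj (le_refl ((u' * ‖x' - ξ'‖ ^ 2 : ℝ) : EReal))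
  rw [← EReal.coe_sub] at hsub
  by_cases hS : ξ' ∈ S
  · simp only [indicatorFn, hS, if_true, add_zero]
    refine le_trans (EReal.coe_le_coe_iff.2 ?_) hsub
    have hr0 : 0 ≤ r := (norm_nonneg _).trans hx'
    have hd := infDist_eq_of_mem_proj hξ
    have hproj : ‖x - ξ‖ ^ 2 ≤ ‖x - ξ'‖ ^ 2 := by
      rw [← hd, ← dist_eq_norm]
      exact pow_le_pow_left₀ Metric.infDist_nonneg (Metric.infDist_le_dist_of_mem hS) 2
    have hexp : ‖x' - ξ'‖ ^ 2 = ‖x - ξ'‖ ^ 2 + 2 * inner ℝ (x - ξ) (x' - x) +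
        2 * inner ℝ (ξ - ξ') (x' - x) + ‖x' - x‖ ^ 2 := by
      rw [show x' - ξ' = (x - ξ') + (x' - x) by abel, norm_add_sq_real,
        show x - ξ' = (x - ξ) + (ξ - ξ') by abel, inner_add_left]
      ring
    have hcs : |inner ℝ (ξ - ξ') (x' - x)| ≤ r * r :=
      (abs_real_inner_le_norm _ _).trans
        (mul_le_mul (by rwa [norm_sub_rev]) hx' (norm_nonneg _) hr0)
    have hq : |‖x' - ξ'‖ ^ 2 - ‖x - ξ‖ ^ 2| ≤ 4 * (1 + ‖x - ξ‖) * r := by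
      refine abs_norm_sq_sub_norm_sq_le hr ?_
      rw [show x' - ξ' - (x - ξ) = (x' - x) - (ξ' - ξ) by abel]
      linarith [norm_sub_le (x' - x) (ξ' - ξ)]
    rw [← hd, ← hs] at hq
    rw [← hd, ← hs] at hproj
    have hprod : (u' + rightDeriv ψ s) * (‖x' - ξ'‖ ^ 2 - s) ≤
        r * (4 * (1 + Metric.infDist x S) * r) :=
      (le_abs_self _).trans (by
        rw [abs_mul]; exact mul_le_mul hu' hq (abs_nonneg _) hr0)
    have hlow : 2 * inner ℝ (x - ξ) (x' - x) - 2 * r ^ 2 ≤ ‖x' - ξ'‖ ^ 2 - s := by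
      nlinarith [neg_abs_le (inner ℝ (ξ - ξ') (x' - x)), sq_nonneg ‖x' - x‖]
    have := mul_le_mul_of_nonneg_left hlow (hψ.rightDeriv_pos hs0).le
    nlinarith
  · simp only [indicatorFn, hS, if_false]
    rw [EReal.add_top_of_ne_bot]
    · exact le_top
    · exact fun h => EReal.coe_ne_bot _ (le_bot_iff.1 (h ▸ hsub))

/-- The gradient step direction, padded with zeros, is a regular subgradient of the potential. -/
lemma direction_mem_regularSubdiff (hψ : IsTheta ψ) {x : EuclideanSpace ℝ (Fin n)}
    {ξ : Fin m → EuclideanSpace ℝ (Fin n)} (hξ : ∀ i, ξ i ∈ proj (D i) x) :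
    (WithLp.toLp 2 (direction ψ D x ξ, 0) : LiftedSpace n m) ∈
      regularSubdiff (potential ψ D) (lift ψ D x ξ) := by
  rw [regularSubdiff, Set.mem_ofPred_eq, potential_lift hψ hξ]
  refine ⟨EReal.coe_lt_top _, ?_⟩
  set z := lift ψ D x ξ with hz
  set C := ∑ i, (2 * rightDeriv ψ (Metric.infDist x (D i) ^ 2) +
    4 * (1 + Metric.infDist x (D i))) with hC
  -- Near `z` the potential lies above its affine model minus `C ‖y - z‖²`.
  have hlow : ∀ y : LiftedSpace n m, ‖y - z‖ ≤ 1 →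
      ((objective ψ D x + inner ℝ (direction ψ D x ξ) (y.fst - x) - C * ‖y - z‖ ^ 2 : ℝ) : EReal) ≤
        potential ψ D y := by
    intro y hy
    have hsnd : ‖y.snd - z.snd‖ ≤ ‖y - z‖ := WithLp.norm_snd_le _ (y - z)
    rw [inner_direction, objective, hC, Finset.sum_mul, ← Finset.sum_add_distrib,
      ← Finset.sum_sub_distrib, coe_ereal_sum]
    refine Finset.sum_le_sum fun i _ => potential_term_ge hψ (hξ i) hy (WithLp.norm_fst_le _ (y - z))
      ?_ ?_
    · exact (PiLp.norm_apply_le (y.snd.fst - z.snd.fst) i).trans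
        ((WithLp.norm_fst_le _ (y.snd - z.snd)).trans hsnd)
    · have := (PiLp.norm_apply_le (y.snd.snd - z.snd.snd) i).trans
        ((WithLp.norm_snd_le _ (y.snd - z.snd)).trans hsnd)
      simpa [hz, lift, sub_neg_eq_add] using this
  refine le_of_forall_lt fun c hc => ?_
  obtain ⟨c', hcc', hc'⟩ := exists_between hc
  refine hcc'.trans_le (le_liminf_of_le (by isBoundedDefault) ?_)
  have htend : Tendsto (fun y : LiftedSpace n m => ((-(C * ‖y - z‖) : ℝ) : EReal)) (𝓝[≠] z)
      (𝓝 0) := by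
    have : Continuous fun y : LiftedSpace n m => ((-(C * ‖y - z‖) : ℝ) : EReal) :=
      continuous_coe_real_ereal.comp (by fun_prop)
    have h := (this.tendsto z).mono_left (nhdsWithin_le_nhds (s := {z}ᶜ))
    simpa using h
  filter_upwards [htend.eventually (lt_mem_nhds hc'),
    nhdsWithin_le_nhds (Metric.closedBall_mem_nhds z one_pos), self_mem_nhdsWithin]
    with y h1 h2 h3
  have hy0 : 0 < ‖y - z‖ := norm_pos_iff.2 (sub_ne_zero.2 h3)
  refine h1.le.trans ?_
  rw [EReal.le_div_iff_mul_le (EReal.coe_pos.2 hy0) (EReal.coe_ne_top _), ← EReal.coe_mul]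
  have h4 := hlow y (mem_closedBall_iff_norm.1 h2)
  have hin : (inner ℝ (WithLp.toLp 2 (direction ψ D x ξ, 0) : LiftedSpace n m) (y - z) : ℝ) =
      inner ℝ (direction ψ D x ξ) (y.fst - x) := by
    simp [WithLp.prod_inner_apply, hz, lift]
  rw [hin]
  have h5 := EReal.sub_le_sub (EReal.sub_le_sub h4 (le_refl (objective ψ D x : EReal)))
    (le_refl ((inner ℝ (direction ψ D x ξ) (y.fst - x) : ℝ) : EReal))
  rw [← EReal.coe_sub, ← EReal.coe_sub] at h5
  refine le_trans (EReal.coe_le_coe_iff.2 (le_of_eq ?_)) h5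
  ring

lemma regularSubdiff_subset_limitingSubdiff {E : Type*} [NormedAddCommGroup E]
    [InnerProductSpace ℝ E] (f : E → EReal) (x : E) :
    regularSubdiff f x ⊆ limitingSubdiff f x := fun v hv =>
  ⟨hv.1, fun _ => x, fun _ => v, tendsto_const_nhds, tendsto_const_nhds, fun _ => hv,
    tendsto_const_nhds⟩

lemma infEDist_limitingSubdiff_le (hψ : IsTheta ψ) {x : EuclideanSpace ℝ (Fin n)}
    {ξ : Fin m → EuclideanSpace ℝ (Fin n)} (hξ : ∀ i, ξ i ∈ proj (D i) x) :
    Metric.infEDist 0 (limitingSubdiff (potential ψ D) (lift ψ D x ξ)) ≤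
      ENNReal.ofReal ‖direction ψ D x ξ‖ := by
  refine (Metric.infEDist_le_edist_of_mem (regularSubdiff_subset_limitingSubdiff _ _
    (direction_mem_regularSubdiff hψ hξ))).trans (le_of_eq ?_)
  rw [edist_dist, dist_zero_left]
  congr 1
  exact WithLp.norm_toLp_fst 2 _ _ _

end Lift

end SGP

namespace SGP

/-! ### Finite length of the iterates -/

lemma IsDesingularizing.le_tangent {ν : EReal} {φ : ℝ → ℝ} (h : IsDesingularizing ν φ) {a b : ℝ}
    (ha : 0 < a) (haν : (a : EReal) < ν) (hb : 0 ≤ b) (hbν : (b : EReal) < ν) :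
    φ b ≤ φ a + deriv φ a * (b - a) := by
  have hopen : IsOpen {s : ℝ | 0 < s ∧ (s : EReal) < ν} :=
    (isOpen_lt continuous_const continuous_id).inter
      (isOpen_lt continuous_coe_real_ereal continuous_const)
  exact le_tangent_of_concaveOn h.concaveOn ⟨ha.le, haν⟩ ⟨hb, hbν⟩
    ((h.contDiffOn.differentiableOn one_ne_zero).differentiableAt
      (hopen.mem_nhds ⟨ha, haν⟩)).hasDerivAt

lemma IsDesingularizing.monotone {ν : EReal} {φ : ℝ → ℝ} (h : IsDesingularizing ν φ) {a b : ℝ}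
    (haν : (a : EReal) < ν) (hb : 0 ≤ b) (hba : b ≤ a) : φ b ≤ φ a := by
  rcases (hb.trans hba).eq_or_lt with rfl | ha
  · rw [le_antisymm hba hb]
  · have h1 := h.le_tangent ha haν hb ((EReal.coe_le_coe_iff.2 hba).trans_lt haν)
    nlinarith [h.deriv_pos a ha haν]

/-- Passing from local to global desingularization: if near every point of a compact set containing
the sequence `p` the step lengths `ℓ` are eventually controlled by the decrease of some nonnegative
function `Φ` of the gaps `a`, then the step lengths are summable. Near a non-cluster point of `p`
the hypothesis is void, and on a union of two sets the functions `Φ` are added, so that no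
desingularizing function common to all points is needed. -/
lemma summable_of_locally_controlled {X : Type*} [TopologicalSpace X] {K : Set X}
    (hK : IsCompact K) {p : ℕ → X} (hp : ∀ t, p t ∈ K) {a ℓ : ℕ → ℝ} (hℓ : ∀ t, 0 ≤ ℓ t)
    (hloc : ∀ q ∈ K, MapClusterPt q atTop p → ∃ U ∈ 𝓝 q, ∃ Φ : ℝ → ℝ,
      (∀ᶠ t in atTop, 0 ≤ Φ (a t) ∧ Φ (a (t + 1)) ≤ Φ (a t)) ∧
      ∀ᶠ t in atTop, p t ∈ U → ℓ t ≤ Φ (a t) - Φ (a (t + 1))) :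
    Summable ℓ := by
  have key : ∃ Φ : ℝ → ℝ, (∀ᶠ t in atTop, 0 ≤ Φ (a t) ∧ Φ (a (t + 1)) ≤ Φ (a t)) ∧
      ∀ᶠ t in atTop, p t ∈ K → ℓ t ≤ Φ (a t) - Φ (a (t + 1)) := by
    refine hK.induction_on (p := fun U => ∃ Φ : ℝ → ℝ,
      (∀ᶠ t in atTop, 0 ≤ Φ (a t) ∧ Φ (a (t + 1)) ≤ Φ (a t)) ∧
      ∀ᶠ t in atTop, p t ∈ U → ℓ t ≤ Φ (a t) - Φ (a (t + 1))) ?_ ?_ ?_ ?_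
    · exact ⟨0, by simp, by simp⟩
    · rintro U V hUV ⟨Φ, h1, h2⟩
      exact ⟨Φ, h1, h2.mono fun t ht hU => ht (hUV hU)⟩
    · rintro U V ⟨Φ, h1, h2⟩ ⟨Φ', h1', h2'⟩
      refine ⟨Φ + Φ', ?_, ?_⟩
      · filter_upwards [h1, h1'] with t ht ht'
        simp only [Pi.add_apply]
        exact ⟨add_nonneg ht.1 ht'.1, add_le_add ht.2 ht'.2⟩
      · filter_upwards [h1, h1', h2, h2'] with t ht ht' k k' hUV
        simp only [Pi.add_apply]
        rcases hUV with hU | hV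
        · linarith [k hU, ht'.2]
        · linarith [k' hV, ht.2]
    · intro q hq
      by_cases hc : MapClusterPt q atTop p
      · obtain ⟨U, hU, h⟩ := hloc q hq hc
        exact ⟨U, mem_nhdsWithin_of_mem_nhds hU, h⟩
      · rw [mapClusterPt_iff_frequently] at hc
        push Not at hc
        obtain ⟨U, hU, h⟩ := hc
        exact ⟨U, mem_nhdsWithin_of_mem_nhds hU, 0, by simp, h.mono fun t ht hU => absurd hU ht⟩
  obtain ⟨Φ, h1, h2⟩ := key
  obtain ⟨T, hT⟩ := eventually_atTop.1 (h1.and h2)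
  rw [← summable_nat_add_iff T]
  refine summable_of_sum_range_le (c := Φ (a T)) (fun t => hℓ _) fun N => ?_
  have : ∑ t ∈ Finset.range N, ℓ (t + T) ≤ Φ (a T) - Φ (a (N + T)) := by
    induction N with
    | zero => simp
    | succ N ih =>
      have := (hT (N + T) (Nat.le_add_left _ _)).2 (hp _)
      rw [Finset.sum_range_succ, show N + 1 + T = N + T + 1 by omega]
      linarith
  linarith [(hT (N + T) (Nat.le_add_left _ _)).1.1]

section Convergence

variable {n m : ℕ} {ψ : ℝ → ℝ} {D : Fin m → Set (EuclideanSpace ℝ (Fin n))}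

lemma continuous_rightDeriv_infDist (hψ : IsTheta ψ) (S : Set (EuclideanSpace ℝ (Fin n))) :
    Continuous fun x => rightDeriv ψ (Metric.infDist x S ^ 2) :=
  hψ.continuousOn_rightDeriv.comp_continuous ((Metric.continuous_infDist_pt S).pow 2)
    fun _ => Set.mem_Ici.2 (sq_nonneg _)

lemma continuous_lift (hψ : IsTheta ψ) :
    Continuous fun q : EuclideanSpace ℝ (Fin n) × (Fin m → EuclideanSpace ℝ (Fin n)) =>
      lift ψ D q.1 q.2 := by
  have := fun i => (continuous_rightDeriv_infDist hψ (D i)).comp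
    (continuous_fst (X := EuclideanSpace ℝ (Fin n)) (Y := Fin m → EuclideanSpace ℝ (Fin n)))
  simp only [Function.comp_def] at this
  unfold lift
  fun_prop

lemma continuous_direction (hψ : IsTheta ψ) :
    Continuous fun q : EuclideanSpace ℝ (Fin n) × (Fin m → EuclideanSpace ℝ (Fin n)) =>
      direction ψ D q.1 q.2 := by
  have := fun i => (continuous_rightDeriv_infDist hψ (D i)).comp
    (continuous_fst (X := EuclideanSpace ℝ (Fin n)) (Y := Fin m → EuclideanSpace ℝ (Fin n)))
  simp only [Function.comp_def] at this
  unfold direction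
  fun_prop

lemma isClosed_setOf_mem_proj {S : Set (EuclideanSpace ℝ (Fin n))} (hS : IsClosed S) :
    IsClosed {q : EuclideanSpace ℝ (Fin n) × EuclideanSpace ℝ (Fin n) | q.2 ∈ proj S q.1} :=
  (hS.preimage continuous_snd).inter (isClosed_eq continuous_dist
    ((Metric.continuous_infDist_pt S).comp continuous_fst))

/-- The basic estimate of the Kurdyka–Łojasiewicz method. At the lift of `x` the slope of the
potential is at most the norm of the step direction, hence at most a multiple of the step length,
whereas `Ψ` decreases by a multiple of its square. -/
lemma kl_step (hψ : IsTheta ψ) {x₀ x x' : EuclideanSpace ℝ (Fin n)}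
    {ξ₀ ξ : Fin m → EuclideanSpace ℝ (Fin n)} (hξ₀ : ∀ i, ξ₀ i ∈ proj (D i) x₀)
    (hξ : ∀ i, ξ i ∈ proj (D i) x) {ν : EReal} {φ : ℝ → ℝ} (hφ : IsDesingularizing ν φ)
    (hKL : potential ψ D (lift ψ D x₀ ξ₀) < potential ψ D (lift ψ D x ξ) →
      potential ψ D (lift ψ D x ξ) < potential ψ D (lift ψ D x₀ ξ₀) + ν →
      1 ≤ ENNReal.ofReal (deriv φ ((potential ψ D (lift ψ D x ξ)).toReal -
        (potential ψ D (lift ψ D x₀ ξ₀)).toReal)) *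
        Metric.infEDist 0 (limitingSubdiff (potential ψ D) (lift ψ D x ξ)))
    {c σ : ℝ} (hσ : 0 < σ) (hstep : c * ‖direction ψ D x ξ‖ ≤ ‖x' - x‖) (hc : 0 < c)
    (hdec : objective ψ D x' + σ / 2 * ‖x' - x‖ ^ 2 ≤ objective ψ D x)
    (hlow : objective ψ D x₀ ≤ objective ψ D x')
    (hν : ((objective ψ D x - objective ψ D x₀ : ℝ) : EReal) < ν) :
    σ / 2 * c * ‖x' - x‖ ≤ φ (objective ψ D x - objective ψ D x₀) -
      φ (objective ψ D x' - objective ψ D x₀) := by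
  have hsq : 0 ≤ σ / 2 * ‖x' - x‖ ^ 2 := by positivity
  rw [potential_lift hψ hξ₀, potential_lift hψ hξ, EReal.toReal_coe, EReal.toReal_coe] at hKL
  set a := objective ψ D x - objective ψ D x₀ with ha
  set b := objective ψ D x' - objective ψ D x₀ with hb
  have hb0 : 0 ≤ b := sub_nonneg.2 hlow
  have hba : b + σ / 2 * ‖x' - x‖ ^ 2 ≤ a := by linarith
  have hbν : (b : EReal) < ν := (EReal.coe_le_coe_iff.2 (by linarith)).trans_lt hν
  rcases (show 0 ≤ a by linarith).eq_or_lt with ha0 | ha0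
  · have h0 : ‖x' - x‖ = 0 := by
      have : σ / 2 * ‖x' - x‖ ^ 2 = 0 := by linarith
      have := (mul_eq_zero.1 this).resolve_left (by positivity)
      exact pow_eq_zero_iff two_ne_zero |>.1 this
    have : b = a := by linarith
    rw [h0, this]
    simp
  · have h1 := hKL (EReal.coe_lt_coe_iff.2 (by linarith)) (by
      rw [show objective ψ D x = objective ψ D x₀ + a by rw [ha]; ring, EReal.coe_add]
      exact EReal.add_lt_add_left_coe hν _)
    have hφ' := hφ.deriv_pos a ha0 hν
    have h2 : 1 ≤ deriv φ a * ‖direction ψ D x ξ‖ := by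
      rw [← ENNReal.one_le_ofReal, ENNReal.ofReal_mul hφ'.le]
      exact h1.trans (mul_le_mul_right (infEDist_limitingSubdiff_le hψ hξ) _)
    have h3 := hφ.le_tangent ha0 hν hb0 hbν
    have h4 : c ≤ deriv φ a * ‖x' - x‖ := by
      have := mul_le_mul_of_nonneg_left hstep hφ'.le
      nlinarith
    have h5 : σ / 2 * ‖x' - x‖ * c ≤ σ / 2 * ‖x' - x‖ * (deriv φ a * ‖x' - x‖) :=
      mul_le_mul_of_nonneg_left h4 (by positivity)
    have h6 := mul_le_mul_of_nonneg_left hba hφ'.le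
    nlinarith

lemma zero_mem_normalCone_univ {E : Type*} [NormedAddCommGroup E] [InnerProductSpace ℝ E] (x : E) :
    (0 : E) ∈ normalCone Set.univ x := by
  refine regularSubdiff_subset_limitingSubdiff _ _ ⟨by simp [indicatorFn], ?_⟩
  exact le_liminf_of_le (by isBoundedDefault) (by simp [indicatorFn])

end Convergence

end SGP

/-! ### Convergence to a stationary point -/

theorem mainTheorem3 {n m : ℕ} (D : Fin m → Set (EuclideanSpace ℝ (Fin n)))
    (hD_nonempty : ∀ i, (D i).Nonempty) (hD_closed : ∀ i, IsClosed (D i))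
    (hD_horizon : ⋂ i, SGP.horizonCone (D i) = {0})
    (ψ : ℝ → ℝ) (hψ : SGP.IsTheta ψ)
    (hKL : SGP.IsKLFunction (SGP.potential ψ D))
    (αmin αmax η σ : ℝ) (x : ℕ → EuclideanSpace ℝ (Fin n))
    (hx : SGP.IsGenerated Set.univ D ψ αmin αmax η σ 0 x) :
    ∃ xbar : EuclideanSpace ℝ (Fin n),
      Filter.Tendsto x Filter.atTop (nhds xbar) ∧ SGP.IsStationary Set.univ D ψ xbar := by
  obtain ⟨c, hc, hstep⟩ := hx.exists_step hψ
  choose ξ hξ hdir hdec using hstep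
  have hσ := hx.σ_pos
  have hanti : Antitone fun t => SGP.objective ψ D (x t) := antitone_nat_of_succ_le fun t => by
    have : 0 ≤ σ / 2 * ‖x (t + 1) - x t‖ ^ 2 := by positivity
    linarith [hdec t]
  obtain ⟨L, hL⟩ : ∃ L, Tendsto (fun t => SGP.objective ψ D (x t)) atTop (𝓝 L) :=
    ⟨_, tendsto_atTop_ciInf hanti ⟨0, by rintro _ ⟨t, rfl⟩; exact SGP.objective_nonneg hψ _⟩⟩
  have hLle : ∀ t, L ≤ SGP.objective ψ D (x t) := hanti.le_of_tendsto hL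
  -- The step directions tend to zero.
  have hlen : Tendsto (fun t => ‖x (t + 1) - x t‖) atTop (𝓝 0) := by
    have h1 : Tendsto (fun t => 2 / σ * (SGP.objective ψ D (x t) - SGP.objective ψ D (x (t + 1))))
        atTop (𝓝 0) := by
      simpa using (hL.sub (hL.comp (tendsto_add_atTop_nat 1))).const_mul (2 / σ)
    have h2 : Tendsto (fun t => ‖x (t + 1) - x t‖ ^ 2) atTop (𝓝 0) := by
      refine squeeze_zero (fun t => sq_nonneg _) (fun t => ?_) h1
      have := hdec t
      field_simp
      linarith
    simpa using h2.sqrt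
  have hdir0 : Tendsto (fun t => SGP.direction ψ D (x t) (ξ t)) atTop (𝓝 0) := by
    refine squeeze_zero_norm (fun t => ?_) (by simpa using hlen.const_mul c⁻¹)
    rw [inv_mul_eq_div, le_div_iff₀ hc, mul_comm]
    exact hdir t
  -- The pairs of iterates and projections stay in a compact set.
  obtain ⟨R, hR⟩ : ∃ R, ∀ t, (x t, ξ t) ∈
      Metric.closedBall (0 : EuclideanSpace ℝ (Fin n) × (Fin m → EuclideanSpace ℝ (Fin n))) R := by
    obtain ⟨B, hB⟩ := (SGP.isBounded_objective_le hψ hD_nonempty hD_closed hD_horizon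
      (SGP.objective ψ D (x 0))).exists_norm_le
    have hxB : ∀ t, ‖x t‖ ≤ B := fun t => hB _ (hanti (Nat.zero_le t))
    have hB0 : 0 ≤ B := (norm_nonneg _).trans (hxB 0)
    have hsum : 0 ≤ ∑ i, Metric.infDist 0 (D i) :=
      Finset.sum_nonneg fun _ _ => Metric.infDist_nonneg
    refine ⟨B + B + ∑ i, Metric.infDist 0 (D i), fun t => ?_⟩
    rw [mem_closedBall_zero_iff, Prod.norm_mk, sup_le_iff]
    refine ⟨by linarith [hxB t], (pi_norm_le_iff_of_nonneg (by positivity)).2 fun i => ?_⟩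
    have h1 := Metric.infDist_le_infDist_add_dist (x := x t) (y := 0) (s := D i)
    rw [SGP.infDist_eq_of_mem_proj (hξ t i), dist_zero_right] at h1
    have h2 := Finset.single_le_sum (f := fun i => Metric.infDist 0 (D i))
      (fun j _ => Metric.infDist_nonneg) (Finset.mem_univ i)
    have h3 := norm_sub_norm_le (ξ t i) (x t)
    rw [norm_sub_rev] at h3
    linarith [hxB t]
  -- Cluster points consist of a stationary point with its projections, at the limiting value of `Ψ`.
  have hclus : ∀ q, MapClusterPt q atTop (fun t => (x t, ξ t)) →
      (∀ i, q.2 i ∈ SGP.proj (D i) q.1) ∧ SGP.direction ψ D q.1 q.2 = 0 ∧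
        SGP.objective ψ D q.1 = L := by
    intro q hq
    obtain ⟨θ, hθ, hlim⟩ := hq.tendsto_subseq
    refine ⟨fun i => ?_, ?_, ?_⟩
    · have hcont : Continuous fun r : EuclideanSpace ℝ (Fin n) ×
          (Fin m → EuclideanSpace ℝ (Fin n)) => (r.1, r.2 i) := by fun_prop
      exact (SGP.isClosed_setOf_mem_proj (hD_closed i)).mem_of_tendsto
        ((hcont.tendsto q).comp hlim) (Eventually.of_forall fun k => hξ (θ k) i)
    · exact tendsto_nhds_unique (((SGP.continuous_direction hψ).tendsto q).comp hlim)
        (hdir0.comp hθ.tendsto_atTop)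
    · exact tendsto_nhds_unique
        ((((SGP.continuous_objective hψ).comp continuous_fst).tendsto q).comp hlim)
        (hL.comp hθ.tendsto_atTop)
  have hsummable : Summable fun t => σ / 2 * c * ‖x (t + 1) - x t‖ := by
    refine SGP.summable_of_locally_controlled (isCompact_closedBall _ R) hR
      (a := fun t => SGP.objective ψ D (x t) - L) (fun t => by positivity) fun q _ hq => ?_
    obtain ⟨hproj, -, hval⟩ := hclus q hq
    obtain ⟨N, hN, ν, hν, φ, hφ, hineq⟩ := hKL.2 (SGP.lift ψ D q.1 q.2)
      ⟨_, SGP.regularSubdiff_subset_limitingSubdiff _ _ (SGP.direction_mem_regularSubdiff hψ hproj)⟩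
    have hsmall : ∀ᶠ t in atTop, ((SGP.objective ψ D (x t) - L : ℝ) : EReal) < ν := by
      have : Tendsto (fun t => ((SGP.objective ψ D (x t) - L : ℝ) : EReal)) atTop (𝓝 0) := by
        have h := (continuous_coe_real_ereal.tendsto 0).comp
          (by simpa using hL.sub_const L : Tendsto (fun t => SGP.objective ψ D (x t) - L) atTop (𝓝 0))
        simpa [Function.comp_def] using h
      exact this.eventually (gt_mem_nhds hν)
    refine ⟨_, (SGP.continuous_lift hψ).continuousAt.preimage_mem_nhds hN, φ, ?_, ?_⟩
    · filter_upwards [hsmall] with t ht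
      exact ⟨hφ.nonneg _ (sub_nonneg.2 (hLle t)) ht,
        hφ.monotone ht (sub_nonneg.2 (hLle _)) (sub_le_sub_right (hanti t.le_succ) L)⟩
    · filter_upwards [hsmall] with t ht htN
      have := SGP.kl_step hψ hproj (hξ t) hφ (hineq _ htN) hσ (hdir t) hc (hdec t)
        (hval.trans_le (hLle _)) (by rwa [hval])
      rwa [hval] at this
  have hcauchy : CauchySeq x := by
    refine cauchySeq_of_summable_dist ?_
    rw [summable_mul_left_iff (by positivity)] at hsummable
    simpa only [dist_eq_norm, norm_sub_rev] using hsummable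
  obtain ⟨xbar, hxbar⟩ := cauchySeq_tendsto_of_complete hcauchy
  obtain ⟨q, -, hq⟩ := (isCompact_closedBall _ R).exists_mapClusterPt (f := atTop)
    (tendsto_principal.2 (Eventually.of_forall hR))
  have hq1 : q.1 = xbar := by
    obtain ⟨θ, hθ, hlim⟩ := hq.tendsto_subseq
    exact tendsto_nhds_unique ((continuous_fst.tendsto q).comp hlim)
      (hxbar.comp hθ.tendsto_atTop)
  obtain ⟨hproj, hzero, -⟩ := hclus q hq
  rw [hq1] at hproj hzero
  exact ⟨xbar, hxbar, q.2, hproj, 0, SGP.zero_mem_normalCone_univ xbar, by rw [hzero, add_zero]⟩
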